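/- Let $R$ be a ring (associative, with unit; for instance a commutative coherent ring). Write $R\text{-}\mathrm{fpmod}$ for the category of finitely presented left $R$-modules. For an Ab-category $\mathbf{A}$, a functor $F : \mathbf{A} \to \mathbf{Ab}$ is called finitely presented if there is a morphism $\alpha : X \to Y$ in $\mathbf{A}$ and an exact sequence $\operatorname{Hom}(Y,-) \xrightarrow{(\alpha,-)} \operatorname{Hom}(X,-) \to F \to 0$; $\mathrm{fp}(\mathbf{A},\mathbf{Ab})$ denotes the category of all such functors and all natural transformations between them. Let $\mathcal{C}(R)$ be the Ab-category with a single object whose morphisms are the elements of $R$, where $r$ followed by $s$ is the product $rs$. For an Ab-category $\mathbf{A}$, let $\mathbf{A}^{\oplus}$ be its additive closure: objects are finite families $(A_1,\dots,A_m)$, $m \ge 0$, of objects of $\mathbf{A}$, morphisms $(A_i) \to (B_j)$ are matrices of morphisms $A_i \to B_j$, and composition is matrix multiplication. For an additive category $\mathbf{A}$, let $\mathcal{A}(\mathbf{A})$ be its Freyd category: objects are morphisms $(A \xleftarrow{\rho_A} R_A)$ of $\mathbf{A}$; a morphism from $(A \xleftarrow{\rho_A} R_A)$ to $(B \xleftarrow{\rho_B}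 R_B)$ is represented by a morphism $\alpha : A \to B$ such that $\alpha \circ \rho_A = \rho_B \circ \rho_\alpha$ for some $\rho_\alpha : R_A \to R_B$; two such $\alpha, \alpha'$ are identified if $\alpha - \alpha' = \rho_B \circ \lambda$ for some $\lambda : A \to R_B$; composition and identities are inherited from $\mathbf{A}$. Then there are equivalences of categories \[ R\text{-}\mathrm{fpmod} \simeq \mathcal{A}\big(\mathcal{C}(R)^{\oplus}\big) \qquad\text{and}\qquad \mathrm{fp}\big(R\text{-}\mathrm{fpmod}, \mathbf{Ab}\big) \simeq \mathcal{A}\big(\mathcal{A}(\mathcal{C}(R)^{\oplus})^{\mathrm{op}}\big). \] -/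

import Mathlib

open CategoryTheory CategoryTheory.Limits CategoryTheory.Preadditive Opposite

universe v u

/-- The category `R`-fpmod of finitely presented left `R`-modules, as a full subcategory of the
category of all left `R`-modules. -/
abbrev FPModuleCat (R : Type u) [Ring R] : Type (u + 1) :=
  ObjectProperty.FullSubcategory
    (fun M : ModuleCat.{u} R => Module.FinitePresentation R M)

/-- A ring `R` regarded as an Ab-category with a single object, whose morphisms are the elements of
`R`, where `r` followed by `s` is the product `r * s`. (In `SingleObj M` the composite
`x ≫ y` is `y * x`, hence the opposite ring.) -/
abbrev RingAsCategory (R : Type u) [Ring R] : Type :=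
  SingleObj Rᵐᵒᵖ

/-- The additive closure of an Ab-category: objects are finite families of objects,
morphisms are matrices of morphisms. -/
abbrev AdditiveClosure (A : Type u) [Category.{v} A] [Preadditive A] : Type (max u 1) :=
  Mat_ A

/-- The Freyd category of `A`: an object is a morphism `ρ : R_A ⟶ A'` of `A` (thought of as its
cokernel), a morphism from `ρ : R_A ⟶ A'` to `σ : R_B ⟶ B'` is a morphism `α : A' ⟶ B'` for
which some `R_A ⟶ R_B` completes a commutative square, and `α`, `α'` are identified when `α - α'`
factors through `σ`. In `Arrow A`, `A'` is the right and `R_A` the left object, and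
`RightFreyd A` is the quotient of `Arrow A` by this relation. -/
abbrev FreydCategory (A : Type u) [Category.{v} A] [Preadditive A] : Type (max u v) :=
  RightFreyd A

/-- A covariant functor `F` on `A` with values in abelian groups is finitely presented if there are
a morphism `α : X ⟶ Y` of `A` and an exact sequence `(Y, -) ⟶ (X, -) ⟶ F ⟶ 0`, the first map
being `(α, -)`; that is, `F` is a cokernel of a morphism between representable functors. -/
def IsFinitelyPresentedFunctor {A : Type u} [Category.{v} A] [Preadditive A]
    (F : A ⥤ AddCommGrpCat.{v}) : Prop :=
  ∃ (X Y : A) (α : X ⟶ Y) (p : preadditiveCoyoneda.obj (op X) ⟶ F)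
    (w : preadditiveCoyoneda.map α.op ≫ p = 0),
    Nonempty (IsColimit (CokernelCofork.ofπ p w))

/-- Finitely presented functors are additive, so `fp(A, Ab)` is a full subcategory of the category
of additive functors. -/
theorem IsFinitelyPresentedFunctor.additive {A : Type u} [Category.{v} A] [Preadditive A]
    {F : A ⥤ AddCommGrpCat.{v}} (hF : IsFinitelyPresentedFunctor F) : F.Additive := by
  obtain ⟨X, Y, α, p, w, ⟨h⟩⟩ := hF
  have hp : Epi p := epi_of_isColimit_cofork h
  have hp' : ∀ Z, Epi (p.app Z) := (NatTrans.epi_iff_epi_app p).1 hp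
  refine ⟨fun {Z W f g} => ?_⟩
  rw [← cancel_epi (p.app Z), ← p.naturality, Functor.map_add, add_comp, comp_add,
    p.naturality, p.naturality]

/-- The category `fp(A, Ab)` of finitely presented functors from `A` to abelian groups, with all
natural transformations as morphisms. -/
abbrev FPFunctorCat (A : Type u) [Category.{v} A] [Preadditive A] : Type (max u (v + 1)) :=
  ObjectProperty.FullSubcategory
    (fun F : A ⥤ AddCommGrpCat.{v} => IsFinitelyPresentedFunctor F)

/-! Both equivalences come from one criterion. An additive functor `G : V ⥤ D` extends to the Freyd
category of `V` by sending `ρ` to the cokernel of `G.map ρ`. The extension is fully faithful once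
the values of `G` behave like projectives against these cokernels (`IsRelativelyProjective`), and
its essential image consists of these cokernels. For modules, `G` is `rowVectors`, fully faithful
with free values. For functors, `G` is the Yoneda embedding after an equivalence; relative
projectivity is then the Yoneda lemma, as cokernels of functors are computed pointwise. -/

namespace CategoryTheory.Preadditive

/-! ### Extending an additive functor to the Freyd category -/

section Freyd

variable {V : Type*} [Category* V] {D : Type*} [Category* D] [Preadditive D] [HasCokernels D]

/-- The objects `G.obj W` are projective relative to the cokernels of the morphisms `G.map ρ`, and
`G` is fully faithful in the weak sense that morphisms into these cokernels, and the vanishing of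
such morphisms, are detected in `V`. -/
class IsRelativelyProjective (G : V ⥤ D) : Prop where
  exists_lift {W X Y : V} (ρ : X ⟶ Y) (f : G.obj W ⟶ cokernel (G.map ρ)) :
    ∃ g : W ⟶ Y, G.map g ≫ cokernel.π (G.map ρ) = f
  exists_factor {W X Y : V} (ρ : X ⟶ Y) (g : W ⟶ Y) (hg : G.map g ≫ cokernel.π (G.map ρ) = 0) :
    ∃ h : W ⟶ X, g = h ≫ ρ

/-- A fully faithful additive functor to an abelian category with projective values is relatively
projective. -/
theorem IsRelativelyProjective.of_projective {D : Type*} [Category* D] [Abelian D]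
    (G : V ⥤ D) [G.Full] [G.Faithful] [∀ X, Projective (G.obj X)] :
    IsRelativelyProjective G where
  exists_lift ρ f :=
    ⟨G.preimage (Projective.factorThru f (cokernel.π (G.map ρ))), by simp⟩
  exists_factor ρ g hg := by
    have hS := ShortComplex.exact_cokernel (G.map ρ)
    refine ⟨G.preimage (hS.liftFromProjective (G.map g) hg), G.map_injective ?_⟩
    rw [G.map_comp, G.map_preimage]
    exact (hS.liftFromProjective_comp (G.map g) hg).symm

namespace RightFreyd

variable (G : V ⥤ D)

/-- The functor sending an arrow `ρ` of `V` to the cokernel of `G.map ρ`. -/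
noncomputable def cokernelArrow : Arrow V ⥤ D where
  obj u := cokernel (G.map u.hom)
  map {u v} f := cokernel.map _ _ (G.map f.left) (G.map f.right) (by
    rw [← G.map_comp, ← G.map_comp, Arrow.w])
  map_id u := by
    rw [← cancel_epi (cokernel.π _), cokernel.π_desc]
    exact (congrArg (· ≫ _) (G.map_id _)).trans ((Category.id_comp _).trans
      (Category.comp_id _).symm)
  map_comp f g := by
    rw [← cancel_epi (cokernel.π _), cokernel.π_desc, cokernel.π_desc_assoc, Category.assoc,
      cokernel.π_desc, ← Category.assoc, ← G.map_comp]
    rfl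

theorem π_cokernelArrow_map {u v : Arrow V} (f : u ⟶ v) :
    cokernel.π (G.map u.hom) ≫ (cokernelArrow G).map f =
      G.map f.right ≫ cokernel.π (G.map v.hom) :=
  cokernel.π_desc _ _ _

theorem cokernelArrow_hom_ext {u : Arrow V} {Z : D} {f g : (cokernelArrow G).obj u ⟶ Z}
    (h : cokernel.π (G.map u.hom) ≫ f = cokernel.π (G.map u.hom) ≫ g) : f = g :=
  (cancel_epi (cokernel.π (G.map u.hom))).1 h

variable [Preadditive V] [G.Additive]

theorem cokernelArrow_map_add {u v : Arrow V} (f g : u ⟶ v) :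
    (cokernelArrow G).map (f + g) = (cokernelArrow G).map f + (cokernelArrow G).map g := by
  apply cokernelArrow_hom_ext
  rw [π_cokernelArrow_map]
  refine Eq.trans ?_ (comp_add _ _ _ _ _ _).symm
  rw [π_cokernelArrow_map, π_cokernelArrow_map]
  exact (congrArg (· ≫ cokernel.π (G.map v.hom)) (G.map_add (f := f.right))).trans
    (add_comp _ _ _ _ _ _)

theorem cokernelArrow_map_eq_iff {u v : Arrow V} (f g : u ⟶ v) :
    (cokernelArrow G).map f = (cokernelArrow G).map g ↔
      G.map (f.right - g.right) ≫ cokernel.π (G.map v.hom) = 0 := by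
  rw [G.map_sub, sub_comp, sub_eq_zero, ← π_cokernelArrow_map, ← π_cokernelArrow_map]
  exact ⟨fun h => by rw [h], cokernelArrow_hom_ext G⟩

/-- The extension of an additive functor `G` to the Freyd category, sending `ρ` to the cokernel of
`G.map ρ`. -/
noncomputable def lift : RightFreyd V ⥤ D :=
  CategoryTheory.Quotient.lift _ (cokernelArrow G) (by
    rintro u v f g ⟨h⟩
    rw [cokernelArrow_map_eq_iff, h.comm, G.map_comp, Category.assoc, cokernel.condition,
      comp_zero])

instance : (lift G).Additive where
  map_add {u v f g} := by
    obtain ⟨f, rfl⟩ := (quotient V).map_surjective (X := u.as) (Y := v.as) f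
    obtain ⟨g, rfl⟩ := (quotient V).map_surjective (X := u.as) (Y := v.as) g
    exact cokernelArrow_map_add G f g

/-- Comparison of projective presentations: lift the map to generators; the relations then die in
the target cokernel, so they lift too. -/
instance [IsRelativelyProjective G] : (lift G).Full where
  map_surjective {u v} f := by
    let f' : cokernel (G.map u.as.hom) ⟶ cokernel (G.map v.as.hom) := f
    obtain ⟨g, hg⟩ := IsRelativelyProjective.exists_lift v.as.hom
      (cokernel.π (G.map u.as.hom) ≫ f')
    obtain ⟨h, hh⟩ := IsRelativelyProjective.exists_factor (G := G) v.as.hom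
      (u.as.hom ≫ g) (by
        rw [G.map_comp, Category.assoc, hg, cokernel.condition_assoc, zero_comp])
    refine ⟨(quotient V).map (Arrow.homMk h g hh.symm), cokernelArrow_hom_ext (u := u.as) G ?_⟩
    exact (π_cokernelArrow_map G _).trans hg

/-- The factorization supplied by `exists_factor` is precisely the homotopy that identifies the two
arrows. -/
instance [IsRelativelyProjective G] : (lift G).Faithful where
  map_injective {u v f g} hfg := by
    obtain ⟨f, rfl⟩ := (quotient V).map_surjective (X := u.as) (Y := v.as) f
    obtain ⟨g, rfl⟩ := (quotient V).map_surjective (X := u.as) (Y := v.as) g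
    obtain ⟨h, hh⟩ := IsRelativelyProjective.exists_factor v.as.hom _
      ((cokernelArrow_map_eq_iff G f g).1 hfg)
    exact eq_of_rightHomotopy _ _ ⟨h, hh⟩

variable (P : ObjectProperty D)
  (hP : ∀ Y, P Y ↔ ∃ (A B : V) (ρ : A ⟶ B), Nonempty (cokernel (G.map ρ) ≅ Y))

/-- The extension of `G` to the Freyd category, with values in the full subcategory of cokernels of
morphisms in the image of `G`. -/
noncomputable def liftFullSubcategory : RightFreyd V ⥤ P.FullSubcategory :=
  P.lift (lift G) fun u => (hP _).2 ⟨_, _, u.as.hom, ⟨Iso.refl _⟩⟩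

instance : (liftFullSubcategory G P hP).Additive where
  map_add := P.ι.map_injective (lift G).map_add

instance [IsRelativelyProjective G] : (liftFullSubcategory G P hP).Full :=
  inferInstanceAs (P.lift (lift G) _).Full

instance [IsRelativelyProjective G] : (liftFullSubcategory G P hP).Faithful :=
  inferInstanceAs (P.lift (lift G) _).Faithful

instance : (liftFullSubcategory G P hP).EssSurj where
  mem_essImage Y := by
    obtain ⟨A, B, ρ, ⟨e⟩⟩ := (hP _).1 Y.property
    exact ⟨(quotient V).obj (Arrow.mk ρ), ⟨P.isoMk e⟩⟩

instance [IsRelativelyProjective G] : (liftFullSubcategory G P hP).IsEquivalence where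

end RightFreyd

end Freyd

/-! ### Representable functors are relatively projective -/

section Coyoneda

variable {A : Type u} [Category.{v} A] [Preadditive A]

instance : (preadditiveCoyoneda : Aᵒᵖ ⥤ A ⥤ AddCommGrpCat.{v}).Additive where
  map_add {X Y f g} := by
    ext Z x
    exact add_comp _ _ _ f.unop g.unop x

theorem coyoneda_hom_app_apply {X : Aᵒᵖ} {F : A ⥤ AddCommGrpCat.{v}}
    (f : preadditiveCoyoneda.obj X ⟶ F) {Z : A} (x : X.unop ⟶ Z) :
    f.app Z x = F.map x (f.app X.unop (𝟙 X.unop)) := by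
  have hf := ConcreteCategory.congr_hom (f.naturality x) (𝟙 X.unop)
  have hx : (preadditiveCoyoneda.obj X).map x (𝟙 X.unop) = x := Category.id_comp x
  exact (congrArg (f.app Z) hx).symm.trans hf

/-- A natural transformation out of a representable functor is determined by the image of the
identity. -/
theorem coyoneda_hom_ext {X : Aᵒᵖ} {F : A ⥤ AddCommGrpCat.{v}}
    {f g : preadditiveCoyoneda.obj X ⟶ F}
    (h : f.app X.unop (𝟙 X.unop) = g.app X.unop (𝟙 X.unop)) : f = g := by
  ext Z x
  exact (coyoneda_hom_app_apply f x).trans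
    ((congrArg (F.map _) h).trans (coyoneda_hom_app_apply g x).symm)

theorem coyoneda_map_comp_app_id {X Y : Aᵒᵖ} {F : A ⥤ AddCommGrpCat.{v}} (g : X ⟶ Y)
    (p : preadditiveCoyoneda.obj Y ⟶ F) :
    (preadditiveCoyoneda.map g ≫ p).app X.unop (𝟙 X.unop) = p.app X.unop g.unop :=
  congrArg (p.app X.unop) (Category.comp_id g.unop)

/-- Postcomposing a fully faithful functor with the Yoneda embedding gives a relatively projective
functor. -/
instance isRelativelyProjective_comp_coyoneda {V : Type*} [Category* V]
    (E : V ⥤ Aᵒᵖ) [E.Full] [E.Faithful] :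
    IsRelativelyProjective (E ⋙ preadditiveCoyoneda) where
  exists_lift {W X Y} ρ f := by
    -- The projection is surjective at the representing object, so the image of the identity has a
    -- preimage there; by Yoneda it determines the lift.
    have hπ := (NatTrans.epi_iff_epi_app
      (cokernel.π ((E ⋙ preadditiveCoyoneda).map ρ))).1 inferInstance (E.obj W).unop
    rw [AddCommGrpCat.epi_iff_surjective] at hπ
    obtain ⟨g, hg⟩ := hπ (f.app (E.obj W).unop (𝟙 (E.obj W).unop))
    obtain ⟨g', hg'⟩ := E.map_surjective
      (Quiver.Hom.op (show (E.obj Y).unop ⟶ (E.obj W).unop from g))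
    refine ⟨g', coyoneda_hom_ext ?_⟩
    refine (coyoneda_map_comp_app_id (E.map g') _).trans ?_
    rw [hg']
    exact hg
  exists_factor {W X Y} ρ g hg := by
    -- Evaluation at the representing object is exact.
    have hS := (ShortComplex.exact_cokernel ((E ⋙ preadditiveCoyoneda).map ρ)).map
      ((evaluation A AddCommGrpCat.{v}).obj (E.obj W).unop)
    rw [ShortComplex.ab_exact_iff] at hS
    have h0 : (cokernel.π ((E ⋙ preadditiveCoyoneda).map ρ)).app (E.obj W).unop
        (E.map g).unop = 0 :=
      (coyoneda_map_comp_app_id (E.map g) _).symm.trans (by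
        exact congrArg (fun t => t.app (E.obj W).unop (𝟙 (E.obj W).unop)) hg)
    obtain ⟨h, hh⟩ := hS _ h0
    obtain ⟨h', hh'⟩ := E.map_surjective
      (Quiver.Hom.op (show (E.obj X).unop ⟶ (E.obj W).unop from h))
    refine ⟨h', E.map_injective ?_⟩
    rw [E.map_comp, hh']
    exact Quiver.Hom.unop_inj hh.symm

end Coyoneda

end CategoryTheory.Preadditive

/-! ### Matrices over `R` and finitely presented modules -/

namespace RingAsCategory

variable (R : Type u) [Ring R]

/-- The functor sending a finite family of length `n` to `Rⁿ`, on which matrices act on row vectors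
by right multiplication. -/
noncomputable def rowVectors : AdditiveClosure (RingAsCategory R) ⥤ ModuleCat.{u} R where
  obj X := ModuleCat.of R (X.ι → R)
  map {X Y} f := ModuleCat.ofHom
    (Matrix.vecMulLinear (Matrix.of fun (i : X.ι) (j : Y.ι) => MulOpposite.unop (f i j)))
  map_id X := by
    classical
    refine ModuleCat.hom_ext
      (Eq.trans (congrArg Matrix.vecMulLinear ?_) Matrix.toLinearMapRight'_one)
    ext i j
    by_cases h : i = j
    · subst h
      simp [SingleObj.id_as_one]
    · simp [h, Mat_.id_apply_of_ne]
  map_comp {X Y Z} f g := by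
    classical
    refine ModuleCat.hom_ext
      (Eq.trans (congrArg Matrix.vecMulLinear ?_) (Matrix.toLinearMapRight'_mul _ _))
    ext i j
    -- `SingleObj` and `Rᵐᵒᵖ` each reverse products, so the entries are those of the usual matrix
    -- product.
    exact Finset.unop_sum _ _

instance : (rowVectors R).Additive where
  map_add {X Y f g} := by
    classical
    ext : 1
    exact map_add (Matrix.toLinearMapRight' (R := R)) _ _

instance : (rowVectors R).Full where
  map_surjective {X Y} f := by
    classical
    refine ⟨fun i j => MulOpposite.op (LinearMap.toMatrixRight' f.hom i j), ?_⟩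
    ext : 1
    exact Matrix.toLinearMapRight'.apply_symm_apply f.hom

instance : (rowVectors R).Faithful where
  map_injective {X Y f g} h := by
    classical
    have h' := (Matrix.toLinearMapRight' (R := R)).injective (congrArg ModuleCat.Hom.hom h)
    ext i j
    exact MulOpposite.unop_injective (congrFun (congrFun h' i) j)

instance (X : AdditiveClosure (RingAsCategory R)) : Projective ((rowVectors R).obj X) :=
  ModuleCat.projective_of_free (Pi.basisFun R X.ι)

instance : IsRelativelyProjective (rowVectors R) :=
  .of_projective _

theorem finitePresentation_iff_cokernel_rowVectors (M : ModuleCat.{u} R) :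
    Module.FinitePresentation R M ↔ ∃ (X Y : AdditiveClosure (RingAsCategory R)) (ρ : X ⟶ Y),
      Nonempty (cokernel ((rowVectors R).map ρ) ≅ M) := by
  constructor
  · intro _
    obtain ⟨n, m, f, g, hf, hfg⟩ := Module.FinitePresentation.exists_fin' R M
    let X : AdditiveClosure (RingAsCategory R) := ⟨Fin m, fun _ => SingleObj.star _⟩
    let Y : AdditiveClosure (RingAsCategory R) := ⟨Fin n, fun _ => SingleObj.star _⟩
    let g' : (rowVectors R).obj X ⟶ (rowVectors R).obj Y := ModuleCat.ofHom g
    let f' : (rowVectors R).obj Y ⟶ M := ModuleCat.ofHom f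
    obtain ⟨ρ, hρ⟩ := (rowVectors R).map_surjective g'
    refine ⟨X, Y, ρ, ⟨?_⟩⟩
    rw [hρ]
    have w : g' ≫ f' = 0 := by
      ext : 1
      exact hfg.linearMap_comp_eq_zero
    have : Epi f' := (ModuleCat.epi_iff_surjective _).2 hf
    have hS : (ShortComplex.mk g' f' w).Exact :=
      (ShortComplex.moduleCat_exact_iff_range_eq_ker _).2 hfg.linearMap_ker_eq.symm
    exact (cokernelIsCokernel g').coconePointUniqueUpToIso hS.gIsCokernel
  · rintro ⟨X, Y, ρ, ⟨e⟩⟩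
    have hS := ShortComplex.exact_cokernel ((rowVectors R).map ρ)
    rw [ShortComplex.moduleCat_exact_iff_range_eq_ker] at hS
    have : Module.FinitePresentation R ((rowVectors R).obj Y) :=
      inferInstanceAs (Module.FinitePresentation R (Y.ι → R))
    have : Module.Finite R ((rowVectors R).obj X) :=
      inferInstanceAs (Module.Finite R (X.ι → R))
    -- The kernel of the projection is the range of a map from a finite module, hence finitely
    -- generated.
    have : Module.FinitePresentation R (cokernel ((rowVectors R).map ρ) : ModuleCat R) :=
      Module.finitePresentation_of_surjective (cokernel.π ((rowVectors R).map ρ)).hom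
        ((ModuleCat.epi_iff_surjective _).1 inferInstance)
        (hS ▸ Module.Finite.iff_fg.1 (Module.Finite.range ((rowVectors R).map ρ).hom))
    exact Module.FinitePresentation.of_equiv e.toLinearEquiv

end RingAsCategory

/-- Allowing an equivalence `E` lets the inner Freyd category index the representables directly, so
invariance of the Freyd construction under equivalence is not needed. -/
theorem isFinitelyPresentedFunctor_iff_cokernel {A : Type u} [Category.{v} A] [Preadditive A]
    {V : Type*} [Category* V] (E : V ⥤ Aᵒᵖ) [E.IsEquivalence] (F : A ⥤ AddCommGrpCat.{v}) :
    IsFinitelyPresentedFunctor F ↔ ∃ (X Y : V) (ρ : X ⟶ Y),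
      Nonempty (cokernel ((E ⋙ preadditiveCoyoneda).map ρ) ≅ F) := by
  constructor
  · rintro ⟨X, Y, α, p, w, ⟨h⟩⟩
    -- Conjugating `α.op` by these isomorphisms gives an arrow in the image of `E` with an
    -- isomorphic cokernel.
    let eX := E.objObjPreimageIso (op X)
    let eY := E.objObjPreimageIso (op Y)
    obtain ⟨ρ, hρ⟩ := E.map_surjective (eY.hom ≫ α.op ≫ eX.inv)
    refine ⟨_, _, ρ, ⟨cokernel.mapIso _ (preadditiveCoyoneda.map α.op)
      (preadditiveCoyoneda.mapIso eY) (preadditiveCoyoneda.mapIso eX) ?_ ≪≫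
        (cokernelIsCokernel _).coconePointUniqueUpToIso h⟩⟩
    rw [Functor.comp_map, Functor.mapIso_hom, Functor.mapIso_hom, ← Functor.map_comp,
      ← Functor.map_comp, hρ, Category.assoc, Category.assoc, eX.inv_hom_id, Category.comp_id]
  · rintro ⟨X, Y, ρ, ⟨e⟩⟩
    refine ⟨(E.obj Y).unop, (E.obj X).unop, (E.map ρ).unop,
      cokernel.π ((E ⋙ preadditiveCoyoneda).map ρ) ≫ e.hom, ?_, ⟨?_⟩⟩
    · exact (cokernel.condition_assoc ((E ⋙ preadditiveCoyoneda).map ρ) e.hom).trans zero_comp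
    · exact IsColimit.ofIsoColimit (cokernelIsCokernel ((E ⋙ preadditiveCoyoneda).map ρ))
        (Cofork.ext e rfl)

theorem mainTheorem9 (R : Type u) [Ring R] :
    Nonempty (FPModuleCat R ≌ FreydCategory (AdditiveClosure (RingAsCategory R))) ∧
    Nonempty (FPFunctorCat (FPModuleCat R) ≌
      FreydCategory (FreydCategory (AdditiveClosure (RingAsCategory R)))ᵒᵖ) := by
  let L := RightFreyd.liftFullSubcategory (RingAsCategory.rowVectors R) _
    (RingAsCategory.finitePresentation_iff_cokernel_rowVectors R)
  refine ⟨⟨L.asEquivalence.symm⟩, ⟨?_⟩⟩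
  exact (RightFreyd.liftFullSubcategory (L.op ⋙ preadditiveCoyoneda) _
    (isFinitelyPresentedFunctor_iff_cokernel L.op)).asEquivalence.symm
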